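/- Let $X\neq\{0\}$ be a complex Banach space, $n,k\in\mathbb N$, and for $1\le q\le\infty$ let $B_{\ell_q^n}=\{z\in\mathbb C^n:\|z\|_q<1\}$. Let $\mathcal P^k(\mathbb C^n,X)$ be the space of $k$-homogeneous $X$-valued polynomials $f(z)=\sum_{|\alpha|=k}x_\alpha(f)\,z^\alpha$ with $x_\alpha(f)\in X$, and put $\|f\|_{B_{\ell_q^n}}=\sup\{\|f(z)\|:z\in B_{\ell_q^n}\}$. For $1\le p<\infty$ and $\lambda\ge 1$, the $\lambda_p$-arithmetic Bohr radius of $\mathcal P^k(\mathbb C^n,X)$ on $B_{\ell_q^n}$ is $$A_p^k(B_{\ell_q^n},X,\lambda)=\sup\Big\{\frac1n\sum_{i=1}^n r_i \;:\; r\in\mathbb R^n_{\ge0},\ \sum_{|\alpha|=k}\|x_\alpha(f)\|^p\,r^{p\alpha}\le\lambda\,\|f\|_{B_{\ell_q^n}}^p\ \text{ for all } f\in\mathcal P^k(\mathbb C^n,X)\Big\}.$$ There is an absolute constant $d>0$ (independent of $X,p,\lambda,q,k,n$) such that, for every complex Banach space $X\ne\{0\}$, all $1\le p<\infty$, $\lambda\ge1$,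 $1\le q\le\infty$ and all integers $k,n\ge2$, $$A_p^k(B_{\ell_q^n},X,\lambda)\le d\,\lambda^{\frac1{pk}}\Big(k\,\log k\,(k!)^{2\left(1-\frac1{\min\{2,q\}}\right)}\,n\Big)^{\frac1{2k}}\Big(\frac1n\Big)^{\frac1p+\frac1{\max\{2,q\}}-\frac12},$$ where $1/\infty=0$. -/

import Mathlib

open scoped NNReal ENNReal Nat

namespace Bohr

/-- The open unit ball of `ℓ_q^n`, as a subset of `ℂⁿ`; for `q = ∞` the norm is the sup norm. -/
def lqBall (q : ℝ≥0∞) (n : ℕ) : Set (Fin n → ℂ) :=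
  {z | ‖(WithLp.toLp q z : PiLp q (fun _ : Fin n => ℂ))‖ < 1}

/-- The monomial `z ^ α = z₁ ^ α₁ ⋯ zₙ ^ αₙ`. -/
def monomial {n : ℕ} (α : Fin n → ℕ) (z : Fin n → ℂ) : ℂ :=
  ∏ i, z i ^ α i

/-- `f(z) = ∑_α c_α z ^ α` on `Ω`, the sum running over all multi-indices `α ∈ ℕ₀ⁿ`. -/
def HasMonomialExpansion {n : ℕ} {X : Type*} [NormedAddCommGroup X] [NormedSpace ℂ X]
    (f : (Fin n → ℂ) → X) (c : (Fin n → ℕ) → X) (Ω : Set (Fin n → ℂ)) : Prop :=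
  ∀ z ∈ Ω, HasSum (fun α : Fin n → ℕ => monomial α z • c α) (f z)

/-- The `k`-homogeneous `X`-valued polynomials `f(z) = ∑_{|α| = k} c_α z ^ α` on `ℂⁿ`. -/
def homogeneousPolynomials (k n : ℕ) (X : Type*) [NormedAddCommGroup X] [NormedSpace ℂ X] :
    Set ((Fin n → ℂ) → X) :=
  {f | ∃ c : (Fin n → ℕ) → X, ∀ z : Fin n → ℂ,
    f z = ∑ α ∈ Finset.piAntidiag Finset.univ k, monomial α z • c α}

/-- `‖f‖_Ω = sup {‖f(z)‖ : z ∈ Ω}`, with values in `[0, ∞]`. -/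
noncomputable def supNorm {n : ℕ} {X : Type*} [NormedAddCommGroup X]
    (f : (Fin n → ℂ) → X) (Ω : Set (Fin n → ℂ)) : ℝ≥0∞ :=
  ⨆ z ∈ Ω, ‖f z‖ₑ

/-- `r ∈ ℝⁿ_{≥ 0}` is admissible for the family `F` on `Ω` if
`∑_α ‖x_α(f)‖ ^ p r ^ (p α) ≤ lam ‖f‖_Ω ^ p` for every `f ∈ F`, where the `x_α(f)` are the
coefficients of the monomial expansion of `f` on `Ω`. -/
def IsAdmissible {n : ℕ} {X : Type*} [NormedAddCommGroup X] [NormedSpace ℂ X]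
    (F : Set ((Fin n → ℂ) → X)) (Ω : Set (Fin n → ℂ)) (p lam : ℝ) (r : Fin n → ℝ≥0) : Prop :=
  ∀ f ∈ F, ∀ c : (Fin n → ℕ) → X, HasMonomialExpansion f c Ω →
    ∑' α : Fin n → ℕ, ‖c α‖ₑ ^ p * ((∏ i, r i ^ (p * (α i : ℝ)) : ℝ≥0) : ℝ≥0∞)
      ≤ ENNReal.ofReal lam * supNorm f Ω ^ p

/-- The arithmetic Bohr radius `A_p(F, lam)`: the supremum, in `[0, ∞]`, of the means
`(r₁ + ⋯ + rₙ) / n` over all admissible `r`. -/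
noncomputable def arithmeticBohrRadius {n : ℕ} {X : Type*} [NormedAddCommGroup X]
    [NormedSpace ℂ X] (F : Set ((Fin n → ℂ) → X)) (Ω : Set (Fin n → ℂ)) (p lam : ℝ) : ℝ≥0∞ :=
  ⨆ (r : Fin n → ℝ≥0) (_ : IsAdmissible F Ω p lam r), (((∑ i, r i) / (n : ℝ≥0) : ℝ≥0) : ℝ≥0∞)

end Bohr

/-! Admissibility is tested on one polynomial `∑ ε_α (k!/α!) z^α x` with `‖x‖ = 1` and signs `ε_α`.
If its norm on the ball is at most `M`, then, since `m ≤ m^p` for multinomial coefficients `m`, the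
multinomial theorem gives `(∑ r_i^p)^k ≤ λ M^p`. A `pk`-th root and the power mean inequality bound
the mean of `r` by `λ^(1/(pk)) M^(1/k) n^(-1/p)`.

Good signs are found at random. Let `s = min 2 q`. At a point of the unit ball of `ℓ_s^n` the
squared moduli of the terms sum to at most `k!^(2(1-1/s))` (`sum_multinomial_mul_prod_sq_le`).
Sub-Gaussian tails and a union bound over a net of `exp(O(nk))` points make the polynomial `O(√(nk)
k!^(1-1/s))` on the net; homogeneity and the Schwarz lemma extend this to the ball
(`norm_le_of_net`). For `q > 2`, Hölder's inequality passes from `ℓ_2` to `ℓ_q`. -/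

namespace Bohr

/-! ### Random signs and sub-Gaussian union bounds -/

/-- The sign `±1` attached to a Boolean. -/
def boolSign (b : Bool) : ℝ := if b then 1 else -1

theorem abs_boolSign (b : Bool) : |boolSign b| = 1 := by cases b <;> simp [boolSign]

/-- The sum over signs factors into hyperbolic cosines, and `cosh x ≤ exp (x²/2)`. -/
theorem sum_exp_boolSign_le {ι : Type*} [Fintype ι] [DecidableEq ι] (b : ι → ℝ) (s V : ℝ)
    (hV : ∑ i, b i ^ 2 ≤ V) :
    ∑ e : ι → Bool, Real.exp (s * ∑ i, boolSign (e i) * b i) ≤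
      2 ^ Fintype.card ι * Real.exp (s ^ 2 * V / 2) := by
  have h1 : ∑ e : ι → Bool, Real.exp (s * ∑ i, boolSign (e i) * b i) =
      ∏ i, (2 * Real.cosh (s * b i)) := by
    have : ∀ i, 2 * Real.cosh (s * b i) =
        ∑ c : Bool, Real.exp (s * (boolSign c * b i)) := by
      intro i
      rw [Fintype.sum_bool, Real.cosh_eq]
      simp [boolSign]
      ring
    simp_rw [this, Finset.prod_univ_sum, Fintype.piFinset_univ, Finset.mul_sum, Real.exp_sum]
  rw [h1, Finset.prod_mul_distrib, Finset.prod_const, Finset.card_univ]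
  gcongr
  calc ∏ i, Real.cosh (s * b i) ≤ ∏ i, Real.exp ((s * b i) ^ 2 / 2) :=
        Finset.prod_le_prod (fun i _ => (Real.cosh_pos _).le)
          (fun i _ => Real.cosh_le_exp_half_sq _)
    _ = Real.exp (s ^ 2 * (∑ i, b i ^ 2) / 2) := by
        rw [← Real.exp_sum, Finset.mul_sum, Finset.sum_div]
        simp_rw [mul_pow]
    _ ≤ _ := by gcongr

/-- A union bound for Rademacher sums: some choice of signs makes all of finitely many
sums small. -/
theorem exists_signs_abs_sum_le {ι P : Type*} [Fintype ι] (N : Finset P) (b : P → ι → ℝ)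
    {σ t : ℝ} (hσ : 0 < σ) (ht : 0 ≤ t) (hb : ∀ p ∈ N, ∑ i, b p i ^ 2 ≤ σ ^ 2)
    (hN : 2 * (N.card : ℝ) ≤ Real.exp (t ^ 2 / 2)) :
    ∃ e : ι → Bool, ∀ p ∈ N, |∑ i, boolSign (e i) * b p i| ≤ t * σ := by
  classical
  by_contra! H
  -- Exponential Markov inequality with parameter `±t/σ`: a violated bound makes one of the two
  -- exponentials exceed `exp (t²)`, while their averages over signs are at most `exp (t²/2)`.
  have hlow : ∀ e : ι → Bool, Real.exp (t ^ 2) <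
      ∑ p ∈ N, (Real.exp (t / σ * ∑ i, boolSign (e i) * b p i) +
        Real.exp (-(t / σ) * ∑ i, boolSign (e i) * b p i)) := by
    intro e
    obtain ⟨p, hp, hlt⟩ := H e
    refine lt_of_lt_of_le ?_ (Finset.single_le_sum (f := fun p =>
      (Real.exp (t / σ * ∑ i, boolSign (e i) * b p i) +
        Real.exp (-(t / σ) * ∑ i, boolSign (e i) * b p i))) (fun _ _ => by positivity) hp)
    have key : t ^ 2 ≤ t / σ * |∑ i, boolSign (e i) * b p i| := by
      calc t ^ 2 = t / σ * (t * σ) := by field_simp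
        _ ≤ _ := by gcongr
    refine lt_of_le_of_lt (Real.exp_le_exp.2 key) ?_
    rcases abs_choice (∑ i, boolSign (e i) * b p i) with h | h <;> rw [h]
    · linarith [Real.exp_pos (-(t / σ) * ∑ i, boolSign (e i) * b p i)]
    · rw [mul_neg, ← neg_mul]
      linarith [Real.exp_pos (t / σ * ∑ i, boolSign (e i) * b p i)]
  have h1 := Finset.sum_lt_sum_of_nonempty (s := (Finset.univ : Finset (ι → Bool)))
    Finset.univ_nonempty (fun e _ => hlow e)
  rw [Finset.sum_comm] at h1
  have h2 : ∑ p ∈ N, ∑ e : ι → Bool, (Real.exp (t / σ * ∑ i, boolSign (e i) * b p i) +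
        Real.exp (-(t / σ) * ∑ i, boolSign (e i) * b p i)) ≤
      ∑ p ∈ N, 2 * (2 ^ Fintype.card ι * Real.exp (t ^ 2 / 2)) := by
    refine Finset.sum_le_sum fun p hp => ?_
    rw [Finset.sum_add_distrib]
    have e1 := sum_exp_boolSign_le (b p) (t / σ) (σ ^ 2) (hb p hp)
    have e2 := sum_exp_boolSign_le (b p) (-(t / σ)) (σ ^ 2) (hb p hp)
    have e3 : (t / σ) ^ 2 * σ ^ 2 / 2 = t ^ 2 / 2 := by field_simp
    rw [neg_sq, e3] at e2
    rw [e3] at e1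
    linarith
  have h3 := h1.trans_le h2
  rw [Finset.sum_const, Finset.sum_const, Finset.card_univ, nsmul_eq_mul, nsmul_eq_mul,
    Fintype.card_fun, Fintype.card_bool] at h3
  have h4 : (N.card : ℝ) * (2 * (2 ^ Fintype.card ι * Real.exp (t ^ 2 / 2))) ≤
      2 ^ Fintype.card ι * Real.exp (t ^ 2) := by
    calc (N.card : ℝ) * (2 * (2 ^ Fintype.card ι * Real.exp (t ^ 2 / 2)))
        = 2 ^ Fintype.card ι * ((2 * N.card) * Real.exp (t ^ 2 / 2)) := by ring
      _ ≤ 2 ^ Fintype.card ι * (Real.exp (t ^ 2 / 2) * Real.exp (t ^ 2 / 2)) := by gcongr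
      _ = _ := by rw [← Real.exp_add]; ring_nf
  push_cast at h3
  exact absurd h3 (not_lt.2 h4)

/-- Real and imaginary parts are treated as two real families, which doubles both the number of
constraints and the final bound. -/
theorem exists_signs_norm_sum_le {ι P : Type*} [Fintype ι] (N : Finset P) (b : P → ι → ℂ)
    {σ t : ℝ} (hσ : 0 < σ) (ht : 0 ≤ t) (hb : ∀ p ∈ N, ∑ i, ‖b p i‖ ^ 2 ≤ σ ^ 2)
    (hN : 4 * (N.card : ℝ) ≤ Real.exp (t ^ 2 / 2)) :
    ∃ e : ι → Bool, ∀ p ∈ N, ‖∑ i, (boolSign (e i) : ℂ) * b p i‖ ≤ 2 * (t * σ) := by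
  obtain ⟨e, he⟩ := exists_signs_abs_sum_le (N ×ˢ (Finset.univ : Finset Bool))
    (fun x i => if x.2 then (b x.1 i).re else (b x.1 i).im) (σ := σ) (t := t) hσ ht (by
      rintro ⟨p, c⟩ hp
      refine le_trans (Finset.sum_le_sum fun i _ => ?_) (hb p (Finset.mem_product.1 hp).1)
      rw [sq_le_sq, abs_norm]
      cases c
      · simpa using Complex.abs_im_le_norm _
      · simpa using Complex.abs_re_le_norm _) (by
      simp only [Finset.card_product, Finset.card_univ, Fintype.card_bool]
      push_cast
      linarith)
  refine ⟨e, fun p hp => ?_⟩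
  have h1 := he (p, true) (by simp [hp])
  have h2 := he (p, false) (by simp [hp])
  refine (Complex.norm_le_abs_re_add_abs_im _).trans ?_
  simp only [Complex.re_sum, Complex.im_sum, Complex.re_ofReal_mul, Complex.im_ofReal_mul]
  simp only [if_true, Bool.false_eq_true, if_false] at h1 h2
  linarith

/-! ### Nets of the unit ball and homogeneous functions -/

open MeasureTheory Metric Module in
/-- Volume bound for the cardinality of a separated subset of the unit ball. -/
theorem card_le_of_separated {E : Type*} [NormedAddCommGroup E] [NormedSpace ℝ E]
    [FiniteDimensional ℝ E] {δ : ℝ} (hδ : 0 < δ) (hδ1 : δ ≤ 1) (s : Finset E)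
    (hs : ∀ c ∈ s, ‖c‖ ≤ 1) (h : ∀ c ∈ s, ∀ d ∈ s, c ≠ d → δ ≤ ‖c - d‖) :
    (s.card : ℝ) ≤ (3 / δ) ^ finrank ℝ E := by
  borelize E
  let μ : Measure E := Measure.addHaar
  have hδ2 : 0 < δ / 2 := by positivity
  have D : Set.Pairwise (s : Set E) (Function.onFun Disjoint fun c => ball (c : E) (δ / 2)) := by
    rintro c hc d hd hcd
    apply ball_disjoint_ball
    rw [dist_eq_norm]
    linarith [h c hc d hd hcd]
  have A_subset : (⋃ c ∈ s, ball (c : E) (δ / 2)) ⊆ ball (0 : E) (3 / 2) := by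
    refine Set.iUnion₂_subset fun x hx => ?_
    apply ball_subset_ball'
    rw [dist_zero_right]
    linarith [hs x hx]
  have I : (s.card : ℝ≥0∞) * ENNReal.ofReal ((δ / 2) ^ finrank ℝ E) * μ (ball 0 1) ≤
      ENNReal.ofReal ((3 / 2) ^ finrank ℝ E) * μ (ball 0 1) :=
    calc
      _ = μ (⋃ c ∈ s, ball (c : E) (δ / 2)) := by
        rw [measure_biUnion_finset D fun c _ => measurableSet_ball]
        simp only [μ.addHaar_ball_of_pos _ hδ2]
        simp only [Finset.sum_const, nsmul_eq_mul, mul_assoc]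
      _ ≤ μ (ball (0 : E) (3 / 2)) := measure_mono A_subset
      _ = _ := by rw [μ.addHaar_ball_of_pos _ (by norm_num)]
  have J := (ENNReal.mul_le_mul_iff_left (measure_ball_pos μ _ zero_lt_one).ne'
    measure_ball_lt_top.ne).1 I
  have K := ENNReal.toReal_le_of_le_ofReal (by positivity) J
  rw [ENNReal.toReal_mul, ENNReal.toReal_natCast, ENNReal.toReal_ofReal (by positivity)] at K
  have e : (3 / δ) ^ finrank ℝ E = (3 / 2) ^ finrank ℝ E / (δ / 2) ^ finrank ℝ E := by
    rw [← div_pow]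
    congr 1
    field_simp
  rw [e, le_div_iff₀ (by positivity)]
  exact K

-- A `δ`-separated set of maximal cardinality is a `δ`-net: a point far from all its members could
-- be added.
open Metric Module in
theorem exists_net {E : Type*} [NormedAddCommGroup E] [NormedSpace ℝ E]
    [FiniteDimensional ℝ E] {δ : ℝ} (hδ : 0 < δ) (hδ1 : δ ≤ 1) :
    ∃ N : Finset E, (N.card : ℝ) ≤ (3 / δ) ^ finrank ℝ E ∧ (∀ w ∈ N, ‖w‖ ≤ 1) ∧
      ∀ z : E, ‖z‖ ≤ 1 → ∃ w ∈ N, ‖z - w‖ ≤ δ := by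
  classical
  let S : Set (Finset E) := {s | (∀ c ∈ s, ‖c‖ ≤ 1) ∧ ∀ c ∈ s, ∀ d ∈ s, c ≠ d → δ ≤ ‖c - d‖}
  have hbdd : BddAbove (Finset.card '' S) := by
    refine ⟨⌊(3 / δ) ^ finrank ℝ E⌋₊, ?_⟩
    rintro _ ⟨s, hs, rfl⟩
    exact Nat.le_floor (card_le_of_separated hδ hδ1 s hs.1 hs.2)
  obtain ⟨s, hs, hmax⟩ := Nat.sSup_mem (s := Finset.card '' S)
    ⟨_, ∅, by simp [S], rfl⟩ hbdd
  refine ⟨s, card_le_of_separated hδ hδ1 s hs.1 hs.2, hs.1, fun z hz => ?_⟩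
  by_contra! H
  have hzs : z ∉ s := fun hzs => by simpa using (H z hzs).trans' hδ
  have : insert z s ∈ S := by
    refine ⟨?_, ?_⟩
    · intro c hc
      rcases Finset.mem_insert.1 hc with rfl | hc
      exacts [hz, hs.1 c hc]
    · intro c hc d hd hcd
      rcases Finset.mem_insert.1 hc with hcz | hc' <;>
        rcases Finset.mem_insert.1 hd with hdz | hd'
      · exact absurd (hcz.trans hdz.symm) hcd
      · exact hcz ▸ (H d hd').le
      · rw [norm_sub_rev]
        exact hdz ▸ (H c hc').le
      · exact hs.2 c hc' d hd' hcd
  have := le_csSup hbdd ⟨_, this, rfl⟩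
  rw [← hmax, Finset.card_insert_of_notMem hzs] at this
  omega

open Metric in
/-- A homogeneous holomorphic function is controlled on the unit ball by its values on a net. -/
theorem norm_le_of_net {E : Type*} [NormedAddCommGroup E] [NormedSpace ℂ E]
    [FiniteDimensional ℂ E] {f : E → ℂ} (hf : Differentiable ℂ f) {k : ℕ}
    (hhom : ∀ (c : ℂ) (z : E), f (c • z) = c ^ k * f z) {N : Finset E}
    (hN1 : ∀ w ∈ N, ‖w‖ ≤ 1) (hN : ∀ z : E, ‖z‖ ≤ 1 → ∃ w ∈ N, ‖z - w‖ ≤ (1 / 2) ^ (k + 2))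
    {B : ℝ} (hB : ∀ w ∈ N, ‖f w‖ ≤ B) (z : E) : ‖f z‖ ≤ 2 * B * ‖z‖ ^ k := by
  have : ProperSpace E := FiniteDimensional.proper ℂ E
  obtain ⟨z₀, hz₀, hmax⟩ := (isCompact_closedBall (0 : E) 1).exists_isMaxOn
    ⟨0, by simp⟩ hf.continuous.norm.continuousOn
  have hscale : ∀ x : E, ‖f x‖ ≤ ‖f z₀‖ * ‖x‖ ^ k := by
    intro x
    rcases eq_or_ne x 0 with rfl | hx
    · rcases Nat.eq_zero_or_pos k with rfl | hk
      · have := hmax (show (0 : E) ∈ closedBall 0 1 by simp)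
        simpa using this
      · have := hhom 0 0
        simp only [zero_smul, zero_pow hk.ne', zero_mul] at this
        simp [this, hk.ne']
    · have hx' : ‖x‖ ≠ 0 := norm_ne_zero_iff.2 hx
      have h1 : ((‖x‖ : ℂ)⁻¹ • x) ∈ closedBall (0 : E) 1 := by
        simp [norm_smul, hx']
      have h2 : x = (‖x‖ : ℂ) • ((‖x‖ : ℂ)⁻¹ • x) := by
        rw [smul_smul, mul_inv_cancel₀ (by exact_mod_cast hx'), one_smul]
      have h3 := hmax h1
      simp only [Set.mem_ofPred_eq] at h3
      conv_lhs => rw [h2, hhom]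
      rw [norm_mul, norm_pow, Complex.norm_real, norm_norm, mul_comm]
      gcongr
  have hz₀1 : ‖z₀‖ ≤ 1 := by simpa using hz₀
  obtain ⟨w, hw, hwz⟩ := hN z₀ hz₀1
  set M := ‖f z₀‖ with hM
  have hM0 : 0 ≤ M := norm_nonneg _
  -- Schwarz lemma on the unit ball about `w`, where `‖x‖ ≤ 2` and so `f` varies by at most `2^(k+1)
  -- M`. The mesh `2^(-(k+2))` then leaves an error of `M/2`, which is absorbed.
  have hsch := Complex.dist_le_div_mul_dist_of_mapsTo_ball (f := f) (c := w) (z := z₀)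
    (R₁ := 1) (R₂ := 2 ^ (k + 1) * M) hf.differentiableOn (by
      intro x hx
      have hx2 : ‖x‖ ≤ 2 := by
        have h1 : ‖x - w‖ < 1 := by simpa [dist_eq_norm] using hx
        have h2 := norm_add_le (x - w) w
        rw [sub_add_cancel] at h2
        linarith [hN1 w hw]
      rw [mem_closedBall, dist_eq_norm]
      calc ‖f x - f w‖ ≤ ‖f x‖ + ‖f w‖ := norm_sub_le _ _
        _ ≤ M * ‖x‖ ^ k + M * ‖w‖ ^ k := add_le_add (hscale x) (hscale w)
        _ ≤ M * 2 ^ k + M * 2 ^ k := by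
            have := hN1 w hw
            gcongr
            linarith
        _ = _ := by ring) (by
      rw [mem_ball, dist_eq_norm]
      exact hwz.trans_lt (pow_lt_one₀ (by norm_num) (by norm_num) (by omega)))
  rw [dist_eq_norm, dist_eq_norm, div_one] at hsch
  have h5 : ‖f z₀ - f w‖ ≤ M / 2 := by
    calc _ ≤ 2 ^ (k + 1) * M * (1 / 2) ^ (k + 2) := by
          refine hsch.trans ?_
          gcongr
      _ = M / 2 := by
          rw [pow_succ (1 / 2 : ℝ) (k + 1), one_div, inv_pow]
          field_simp
  have h6 : M ≤ M / 2 + B := by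
    calc M = ‖(f z₀ - f w) + f w‖ := by rw [sub_add_cancel]
      _ ≤ _ := (norm_add_le _ _).trans (add_le_add h5 (hB w hw))
  calc ‖f z‖ ≤ M * ‖z‖ ^ k := hscale z
    _ ≤ _ := by gcongr; linarith

/-! ### Square sums of the terms of the test polynomial -/

theorem sum_rpow_le_rpow_sum {ι : Type*} (s : Finset ι) (f : ι → ℝ) (hf : ∀ i ∈ s, 0 ≤ f i)
    {t : ℝ} (ht : 1 ≤ t) : ∑ i ∈ s, f i ^ t ≤ (∑ i ∈ s, f i) ^ t := by
  have hsplit : ∀ x : ℝ, 0 ≤ x → x ^ t = x * x ^ (t - 1) := fun x hx => by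
    conv_lhs => rw [show t = 1 + (t - 1) by ring]
    rw [Real.rpow_add_of_nonneg hx zero_le_one (by linarith), Real.rpow_one]
  rw [hsplit _ (Finset.sum_nonneg hf), Finset.sum_mul]
  refine Finset.sum_le_sum fun i hi => ?_
  rw [hsplit _ (hf i hi)]
  have h0 := hf i hi
  have h1 := Finset.single_le_sum hf hi
  have : 0 ≤ t - 1 := by linarith
  gcongr

theorem multinomial_le_factorial {n k : ℕ} {α : Fin n → ℕ}
    (hα : α ∈ Finset.piAntidiag Finset.univ k) : Nat.multinomial Finset.univ α ≤ k ! := by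
  rw [← (Finset.mem_piAntidiag.1 hα).1]
  exact Nat.div_le_self _ _

/-- The `ℓ_2` norm is at most the `ℓ_t` norm, and `m^t ≤ k!^(t-1) m` for a multinomial coefficient
`m`; what remains is the expansion of `(∑ x_i^t)^k ≤ 1`. -/
theorem sum_multinomial_mul_prod_sq_le {n k : ℕ} (x : Fin n → ℝ) (hx : ∀ i, 0 ≤ x i) {t : ℝ}
    (ht1 : 1 ≤ t) (ht2 : t ≤ 2) (h : ∑ i, x i ^ t ≤ 1) :
    ∑ α ∈ Finset.piAntidiag Finset.univ k,
      ((Nat.multinomial Finset.univ α : ℝ) * ∏ i, x i ^ α i) ^ 2 ≤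
        ((k ! : ℝ) ^ (1 - t⁻¹)) ^ 2 := by
  have ht0 : 0 < t := by linarith
  have hk : (0 : ℝ) < k ! := by exact_mod_cast k.factorial_pos
  set a : (Fin n → ℕ) → ℝ := fun α => (Nat.multinomial Finset.univ α : ℝ) * ∏ i, x i ^ α i
    with ha
  have ha0 : ∀ α, 0 ≤ a α := fun α =>
    mul_nonneg (Nat.cast_nonneg _) (Finset.prod_nonneg fun i _ => pow_nonneg (hx i) _)
  have hterm : ∀ α ∈ Finset.piAntidiag Finset.univ k, a α ^ t ≤ (k ! : ℝ) ^ (t - 1) *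
      ((Nat.multinomial Finset.univ α : ℝ) * ∏ i, (x i ^ t) ^ α i) := by
    intro α hα
    have hm : (0 : ℝ) < Nat.multinomial Finset.univ α := by
      exact_mod_cast Nat.multinomial_pos _ _
    have hmk : (Nat.multinomial Finset.univ α : ℝ) ≤ k ! := by
      exact_mod_cast multinomial_le_factorial hα
    have e1 : (∏ i, x i ^ α i) ^ t = ∏ i, (x i ^ t) ^ α i := by
      rw [← Real.finsetProd_rpow _ _ (fun i _ => pow_nonneg (hx i) _)]
      refine Finset.prod_congr rfl fun i _ => ?_
      rw [← Real.rpow_natCast, ← Real.rpow_natCast, ← Real.rpow_mul (hx i),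
        ← Real.rpow_mul (hx i), mul_comm]
    rw [ha, Real.mul_rpow hm.le (Finset.prod_nonneg fun i _ => pow_nonneg (hx i) _), e1,
      ← mul_assoc]
    have hp : 0 ≤ ∏ i, (x i ^ t) ^ α i :=
      Finset.prod_nonneg fun i _ => pow_nonneg (Real.rpow_nonneg (hx i) _) _
    refine mul_le_mul_of_nonneg_right ?_ hp
    conv_lhs => rw [show t = (t - 1) + 1 by ring, Real.rpow_add hm, Real.rpow_one]
    have : 0 ≤ t - 1 := by linarith
    gcongr
  have hsum : ∑ α ∈ Finset.piAntidiag Finset.univ k, a α ^ t ≤ (k ! : ℝ) ^ (t - 1) := by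
    refine (Finset.sum_le_sum hterm).trans ?_
    rw [← Finset.mul_sum, ← Finset.sum_pow_eq_sum_piAntidiag]
    refine mul_le_of_le_one_right (by positivity) (pow_le_one₀ ?_ h)
    exact Finset.sum_nonneg fun i _ => Real.rpow_nonneg (hx i) _
  calc ∑ α ∈ Finset.piAntidiag Finset.univ k, a α ^ 2
      = ∑ α ∈ Finset.piAntidiag Finset.univ k, (a α ^ t) ^ (2 / t) := by
        refine Finset.sum_congr rfl fun α _ => ?_
        rw [← Real.rpow_mul (ha0 α), mul_div_cancel₀ _ ht0.ne', Real.rpow_two]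
    _ ≤ (∑ α ∈ Finset.piAntidiag Finset.univ k, a α ^ t) ^ (2 / t) :=
        sum_rpow_le_rpow_sum _ _ (fun α _ => Real.rpow_nonneg (ha0 α) _)
          (by rw [le_div_iff₀ ht0]; linarith)
    _ ≤ ((k ! : ℝ) ^ (t - 1)) ^ (2 / t) := by
        refine Real.rpow_le_rpow (Finset.sum_nonneg fun α _ => Real.rpow_nonneg (ha0 α) _) hsum
          (by positivity)
    _ = _ := by
        rw [← Real.rpow_mul hk.le, ← Real.rpow_two, ← Real.rpow_mul hk.le]
        congr 1
        field_simp

/-! ### The random polynomial -/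

theorem monomial_smul {n k : ℕ} {α : Fin n → ℕ} (hα : α ∈ Finset.piAntidiag Finset.univ k)
    (c : ℂ) (z : Fin n → ℂ) : monomial α (c • z) = c ^ k * monomial α z := by
  simp only [monomial, Pi.smul_apply, smul_eq_mul, mul_pow, Finset.prod_mul_distrib]
  rw [Finset.prod_pow_eq_pow_sum, (Finset.mem_piAntidiag.1 hα).1]

/-- The deviation `t = 4√(nk)` is chosen so that `t²/2 = 8nk` beats the net bound in real dimension
`2n` at mesh `2^(-(k+2))`. -/
theorem four_mul_net_card_le {n k : ℕ} (hk : 2 ≤ k) (hn : 2 ≤ n) :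
    4 * (3 / (1 / 2 : ℝ) ^ (k + 2)) ^ (2 * n) ≤ Real.exp ((4 * √(n * k)) ^ 2 / 2) := by
  have h1 : (3 / (1 / 2 : ℝ) ^ (k + 2)) ≤ 2 ^ (k + 4) := by
    rw [one_div, inv_pow, div_inv_eq_mul, pow_add 2 k 4, pow_add 2 k 2]
    have : (0 : ℝ) < 2 ^ k := by positivity
    linarith
  have h2 : (4 * √((n : ℝ) * k)) ^ 2 / 2 = ((8 * n * k : ℕ) : ℝ) := by
    rw [mul_pow, Real.sq_sqrt (by positivity)]
    push_cast
    ring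
  calc 4 * (3 / (1 / 2 : ℝ) ^ (k + 2)) ^ (2 * n) ≤ 4 * (2 ^ (k + 4)) ^ (2 * n) := by gcongr
    _ = 2 ^ (2 + (k + 4) * (2 * n)) := by
        rw [← pow_mul, pow_add 2 2]
        norm_num
    _ ≤ 2 ^ (8 * n * k) := pow_le_pow_right₀ one_le_two (by nlinarith)
    _ ≤ Real.exp 1 ^ (8 * n * k) := by
        gcongr
        linarith [Real.add_one_le_exp (1 : ℝ)]
    _ = _ := by rw [h2, ← Real.exp_nat_mul, mul_one]

/-- A homogeneous polynomial with unimodular multiples of multinomial coefficients which is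
small on the unit ball of `ℓ_s^n`, for `1 ≤ s ≤ 2`. -/
theorem exists_signs_polynomial {n k : ℕ} (hk : 2 ≤ k) (hn : 2 ≤ n) {s : ℝ≥0∞} (hs1 : 1 ≤ s)
    (hs2 : s ≤ 2) : ∃ ε : (Fin n → ℕ) → ℝ, (∀ α, |ε α| = 1) ∧ ∀ z : Fin n → ℂ,
      ‖∑ α ∈ Finset.piAntidiag Finset.univ k,
        monomial α z * (ε α * (Nat.multinomial Finset.univ α : ℂ))‖ ≤
      16 * √(n * k) * (k ! : ℝ) ^ (1 - (s⁻¹).toReal) *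
        ‖(WithLp.toLp s z : PiLp s (fun _ : Fin n => ℂ))‖ ^ k := by
  have : Fact (1 ≤ s) := ⟨hs1⟩
  have hst : s ≠ ∞ := ne_top_of_le_ne_top (by simp) hs2
  have ht1 : 1 ≤ s.toReal := by simpa using ENNReal.toReal_mono hst hs1
  have ht2 : s.toReal ≤ 2 := by simpa using ENNReal.toReal_mono (by simp) hs2
  have hfin : Module.finrank ℝ (PiLp s (fun _ : Fin n => ℂ)) = 2 * n := by
    rw [(WithLp.linearEquiv s ℝ (Fin n → ℂ)).finrank_eq, Module.finrank_pi_fintype]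
    simp [Complex.finrank_real_complex, mul_comm]
  have hFD : FiniteDimensional ℝ (PiLp s (fun _ : Fin n => ℂ)) :=
    Module.finite_of_finrank_pos (by omega)
  obtain ⟨N, hNc, hN1, hN⟩ := exists_net (E := PiLp s (fun _ : Fin n => ℂ))
    (δ := (1 / 2 : ℝ) ^ (k + 2)) (by positivity) (pow_le_one₀ (by norm_num) (by norm_num))
  rw [hfin] at hNc
  rw [ENNReal.toReal_inv]
  set σ : ℝ := (k ! : ℝ) ^ (1 - s.toReal⁻¹) with hσ
  have hσ0 : 0 < σ := Real.rpow_pos_of_pos (by exact_mod_cast k.factorial_pos) _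
  obtain ⟨e, he⟩ := exists_signs_norm_sum_le
    (ι := (Finset.piAntidiag (Finset.univ : Finset (Fin n)) k)) N
    (fun p α => monomial α.1 (WithLp.ofLp p) * (Nat.multinomial Finset.univ α.1 : ℂ))
    (σ := σ) (t := 4 * √(n * k)) hσ0 (by positivity) (by
      intro p hp
      rw [Finset.sum_coe_sort (Finset.piAntidiag (Finset.univ : Finset (Fin n)) k)
        (fun α => ‖monomial α (WithLp.ofLp p) * (Nat.multinomial Finset.univ α : ℂ)‖ ^ 2)]
      have h1 := sum_multinomial_mul_prod_sq_le (k := k) (fun i => ‖p i‖)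
        (fun i => norm_nonneg _) ht1 ht2 (by
          have h2 := hN1 p hp
          rw [PiLp.norm_eq_sum (by linarith)] at h2
          have h3 : 0 ≤ ∑ i, ‖p i‖ ^ s.toReal :=
            Finset.sum_nonneg fun i _ => Real.rpow_nonneg (norm_nonneg _) _
          by_contra! h4
          exact absurd h2 (not_le.2 (Real.one_lt_rpow h4 (by positivity))))
      refine le_trans (le_of_eq (Finset.sum_congr rfl fun α _ => ?_)) h1
      simp only [monomial, norm_mul, norm_prod, norm_pow, Complex.norm_natCast]
      rw [mul_comm]) (by
      refine le_trans ?_ (four_mul_net_card_le hk hn)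
      gcongr)
  -- Off `|α| = k` the value 1 is a dummy that keeps `|ε α| = 1` everywhere.
  refine ⟨fun α => if h : α ∈ Finset.piAntidiag Finset.univ k then boolSign (e ⟨α, h⟩) else 1,
    fun α => ?_, fun z => ?_⟩
  · dsimp only
    split_ifs
    exacts [abs_boolSign _, abs_one]
  set ε : (Fin n → ℕ) → ℝ := fun α =>
    if h : α ∈ Finset.piAntidiag Finset.univ k then boolSign (e ⟨α, h⟩) else 1 with hε
  have hB : ∀ w ∈ N, ‖∑ α ∈ Finset.piAntidiag Finset.univ k,
      monomial α (WithLp.ofLp w) * (ε α * (Nat.multinomial Finset.univ α : ℂ))‖ ≤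
        2 * (4 * √(n * k) * σ) := by
    intro w hw
    refine le_trans (le_of_eq ?_) (he w hw)
    rw [← Finset.sum_coe_sort (Finset.piAntidiag (Finset.univ : Finset (Fin n)) k)]
    congr 1
    refine Finset.sum_congr rfl fun α _ => ?_
    simp only [hε, α.2, dif_pos]
    ring
  have hdiff : Differentiable ℂ (fun w : PiLp s (fun _ : Fin n => ℂ) =>
      ∑ α ∈ Finset.piAntidiag Finset.univ k,
      monomial α (WithLp.ofLp w) * (ε α * (Nat.multinomial Finset.univ α : ℂ))) := by
    unfold monomial
    fun_prop
  have := norm_le_of_net hdiff (k := k) (by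
      intro c w
      rw [Finset.mul_sum]
      refine Finset.sum_congr rfl fun α hα => ?_
      rw [WithLp.ofLp_smul, monomial_smul hα, mul_assoc]) hN1 hN hB (WithLp.toLp s z)
  refine this.trans (le_of_eq ?_)
  ring

/-! ### From the norm bound to the Bohr radius -/

/-- For `q ≤ 2` the exponent is zero and the norms coincide; for `q > 2` this is Hölder's inequality
between `ℓ_2` and `ℓ_q`. -/
theorem norm_toLp_min_two_le {n : ℕ} {q : ℝ≥0∞} (hq : 1 ≤ q) (z : Fin n → ℂ) :
    ‖(WithLp.toLp (min 2 q) z : PiLp (min 2 q) (fun _ : Fin n => ℂ))‖ ≤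
      (n : ℝ) ^ (1 / 2 - ((max 2 q)⁻¹).toReal) *
        ‖(WithLp.toLp q z : PiLp q (fun _ : Fin n => ℂ))‖ := by
  rcases le_total q 2 with h | h
  · rw [min_eq_right h, max_eq_left h]
    simp
  rw [min_eq_left h, max_eq_right h]
  have hE : ‖(WithLp.toLp 2 z : PiLp 2 (fun _ : Fin n => ℂ))‖ = √(∑ i, ‖z i‖ ^ 2) :=
    EuclideanSpace.norm_eq _
  have hS : 0 ≤ ∑ i, ‖z i‖ ^ 2 := Finset.sum_nonneg fun i _ => by positivity
  rw [hE]
  rcases eq_or_ne q ∞ with rfl | hqt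
  · have h1 : ∀ i, ‖z i‖ ≤ ‖(WithLp.toLp ∞ z : PiLp ∞ (fun _ : Fin n => ℂ))‖ := fun i =>
      PiLp.norm_apply_le (WithLp.toLp ∞ z : PiLp ∞ (fun _ : Fin n => ℂ)) i
    rw [ENNReal.inv_top, ENNReal.toReal_zero, sub_zero, ← Real.sqrt_eq_rpow]
    refine (Real.sqrt_le_sqrt (Finset.sum_le_sum fun i _ =>
      pow_le_pow_left₀ (norm_nonneg _) (h1 i) 2)).trans (le_of_eq ?_)
    rw [Finset.sum_const, Finset.card_univ, Fintype.card_fin, nsmul_eq_mul,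
      Real.sqrt_mul (Nat.cast_nonneg _), Real.sqrt_sq (norm_nonneg _)]
  · have ht : 2 ≤ q.toReal := by simpa using ENNReal.toReal_mono hqt h
    rw [PiLp.norm_eq_sum (by linarith), ENNReal.toReal_inv]
    set t := q.toReal
    have ht0 : 0 < t := by linarith
    have h1 := Real.rpow_sum_le_const_mul_sum_rpow_of_nonneg (p := t / 2)
      (f := fun i => ‖z i‖ ^ 2) Finset.univ (by linarith) (fun i _ => by positivity)
    rw [Finset.card_univ, Fintype.card_fin] at h1
    have h2 : ∀ i, (‖z i‖ ^ 2) ^ (t / 2) = ‖z i‖ ^ t := fun i => by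
      rw [← Real.rpow_two, ← Real.rpow_mul (norm_nonneg _)]
      congr 1
      ring
    simp_rw [h2] at h1
    have hT : 0 ≤ ∑ i, ‖z i‖ ^ t :=
      Finset.sum_nonneg fun i _ => Real.rpow_nonneg (norm_nonneg _) _
    calc √(∑ i, ‖z i‖ ^ 2) = ((∑ i, ‖z i‖ ^ 2) ^ (t / 2)) ^ (1 / t) := by
          rw [← Real.rpow_mul hS, Real.sqrt_eq_rpow]
          congr 1
          field_simp
      _ ≤ ((n : ℝ) ^ (t / 2 - 1) * ∑ i, ‖z i‖ ^ t) ^ (1 / t) :=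
          Real.rpow_le_rpow (Real.rpow_nonneg hS _) h1 (by positivity)
      _ = _ := by
          rw [Real.mul_rpow (by positivity) hT, ← Real.rpow_mul (Nat.cast_nonneg _)]
          congr 2
          field_simp

theorem arith_mean_le_of_sum_rpow_pow_le {n k : ℕ} (hk : k ≠ 0) (r : Fin n → ℝ≥0)
    {p lam D : ℝ} (hp : 1 ≤ p) (hlam : 0 ≤ lam) (hD : 0 ≤ D) (hn : n ≠ 0)
    (h : (∑ i, (r i : ℝ) ^ p) ^ k ≤ lam * (D ^ k) ^ p) :
    (∑ i, (r i : ℝ)) / n ≤ lam ^ (1 / (p * (k : ℝ))) * D * (1 / (n : ℝ)) ^ (1 / p) := by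
  have hp0 : 0 < p := by linarith
  have hk0 : (k : ℝ) ≠ 0 := by exact_mod_cast hk
  have hn0 : (n : ℝ) ≠ 0 := by exact_mod_cast hn
  have hS : 0 ≤ ∑ i, (r i : ℝ) ^ p :=
    Finset.sum_nonneg fun i _ => Real.rpow_nonneg (r i).coe_nonneg _
  have h1 := Real.arith_mean_le_rpow_mean Finset.univ (fun _ : Fin n => 1 / (n : ℝ))
    (fun i => (r i : ℝ)) (fun _ _ => by positivity) (by simp [hn0])
    (fun i _ => (r i).coe_nonneg) hp
  rw [← Finset.mul_sum, ← Finset.mul_sum, Real.mul_rpow (by positivity) hS] at h1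
  have h2 : (∑ i, (r i : ℝ) ^ p) ^ (1 / p) ≤ lam ^ (1 / (p * (k : ℝ))) * D := by
    calc (∑ i, (r i : ℝ) ^ p) ^ (1 / p)
        = ((∑ i, (r i : ℝ) ^ p) ^ k) ^ (1 / (p * k)) := by
          rw [← Real.rpow_natCast, ← Real.rpow_mul hS]
          congr 1
          field_simp
      _ ≤ (lam * (D ^ k) ^ p) ^ (1 / (p * k)) :=
          Real.rpow_le_rpow (by positivity) h (by positivity)
      _ = _ := by
          rw [Real.mul_rpow hlam (by positivity), ← Real.rpow_natCast, ← Real.rpow_mul hD,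
            ← Real.rpow_mul hD, show (k : ℝ) * p * (1 / (p * k)) = 1 by field_simp,
            Real.rpow_one]
  calc (∑ i, (r i : ℝ)) / n = 1 / n * ∑ i, (r i : ℝ) := by ring
    _ ≤ _ := h1
    _ ≤ (1 / (n : ℝ)) ^ (1 / p) * (lam ^ (1 / (p * (k : ℝ))) * D) := by gcongr
    _ = _ := by ring

/-- Testing admissibility on a polynomial whose coefficients have multinomial modulus. -/
theorem IsAdmissible.sum_rpow_pow_le {n k : ℕ} {X : Type*} [NormedAddCommGroup X]
    [NormedSpace ℂ X] [Nontrivial X] {Ω : Set (Fin n → ℂ)} {p lam M : ℝ} {r : Fin n → ℝ≥0}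
    (hr : IsAdmissible (homogeneousPolynomials k n X) Ω p lam r) (hp : 1 ≤ p) (hlam : 0 ≤ lam)
    (hM : 0 ≤ M) {ε : (Fin n → ℕ) → ℝ} (hε : ∀ α, |ε α| = 1)
    (hb : ∀ z ∈ Ω, ‖∑ α ∈ Finset.piAntidiag Finset.univ k,
        monomial α z * (ε α * (Nat.multinomial Finset.univ α : ℂ))‖ ≤ M) :
    (∑ i, (r i : ℝ) ^ p) ^ k ≤ lam * M ^ p := by
  classical
  obtain ⟨x, hx⟩ : ∃ x : X, ‖x‖ = 1 := by
    obtain ⟨y, hy⟩ := exists_ne (0 : X)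
    exact ⟨(‖y‖ : ℂ)⁻¹ • y, by simp [norm_smul, hy]⟩
  set A := Finset.piAntidiag (Finset.univ : Finset (Fin n)) k with hA
  -- Truncation to `|α| = k` makes the expansion over all multi-indices a finite sum.
  set c : (Fin n → ℕ) → X := fun α =>
    if α ∈ A then (ε α * (Nat.multinomial Finset.univ α : ℂ)) • x else 0 with hc
  set f : (Fin n → ℂ) → X := fun z => ∑ α ∈ A, monomial α z • c α with hf
  have hfx : ∀ z, f z = (∑ α ∈ A,
      monomial α z * (ε α * (Nat.multinomial Finset.univ α : ℂ))) • x := by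
    intro z
    rw [hf, Finset.sum_smul]
    refine Finset.sum_congr rfl fun α hα => ?_
    simp only [hc, if_pos hα, smul_smul]
  have hsup : supNorm f Ω ≤ ENNReal.ofReal M := by
    refine iSup₂_le fun z hz => ?_
    rw [← ofReal_norm, hfx, norm_smul, hx, mul_one]
    exact ENNReal.ofReal_le_ofReal (hb z hz)
  have h1 := hr f ⟨c, fun z => rfl⟩ c (fun z _ => by
    refine hasSum_sum_of_ne_finset_zero fun α hα => ?_
    simp [hc, hα])
  have h2 : (((∑ i, r i ^ p) ^ k : ℝ≥0) : ℝ≥0∞) ≤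
      ∑' α : Fin n → ℕ, ‖c α‖ₑ ^ p * ((∏ i, r i ^ (p * (α i : ℝ)) : ℝ≥0) : ℝ≥0∞) := by
    refine le_trans ?_ (ENNReal.sum_le_tsum A)
    rw [Finset.sum_pow_eq_sum_piAntidiag, ENNReal.ofNNReal_finsetSum]
    refine Finset.sum_le_sum fun α (hα : α ∈ A) => ?_
    have e1 : ‖c α‖ₑ = (Nat.multinomial Finset.univ α : ℝ≥0∞) := by
      rw [← ofReal_norm]
      simp only [hc, if_pos hα, norm_smul, hx, mul_one, norm_mul, Complex.norm_real,
        Real.norm_eq_abs, hε, one_mul, Complex.norm_natCast, ENNReal.ofReal_natCast]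
    have e2 : (1 : ℝ≥0∞) ≤ (Nat.multinomial Finset.univ α : ℝ≥0∞) := by
      exact_mod_cast Nat.multinomial_pos _ _
    have e3 : ∏ i, (r i ^ p) ^ α i = ∏ i, r i ^ (p * (α i : ℝ)) :=
      Finset.prod_congr rfl fun i _ => by rw [NNReal.rpow_mul, NNReal.rpow_natCast]
    rw [e1, ENNReal.coe_mul, ENNReal.coe_natCast, e3]
    gcongr
    exact ENNReal.le_rpow_self_of_one_le e2 hp
  have h3 : (((∑ i, r i ^ p) ^ k : ℝ≥0) : ℝ≥0∞) ≤ ENNReal.ofReal (lam * M ^ p) := by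
    refine (h2.trans h1).trans ?_
    rw [ENNReal.ofReal_mul hlam, ← ENNReal.ofReal_rpow_of_nonneg hM (by linarith)]
    gcongr
  have h4 := ENNReal.toReal_le_of_le_ofReal (by positivity) h3
  rw [ENNReal.coe_toReal] at h4
  push_cast at h4
  exact h4

/-- The factor `log k` is pure slack: `log k ≥ 1/2` inserts it under the root at the cost of a
factor 2, and `32 ≤ 32^k` moves the constant inside the `k`-th power. -/
theorem supNorm_bound_le_pow {n k : ℕ} (hk : 2 ≤ k) {K a b : ℝ} (hK : 0 < K) (hn : 2 ≤ n) :
    16 * √(n * k) * K ^ a * ((n : ℝ) ^ b) ^ k ≤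
      (32 * ((k : ℝ) * Real.log k * K ^ (2 * a) * n) ^ (1 / (2 * (k : ℝ))) * (n : ℝ) ^ b) ^ k := by
  have hk2 : (2 : ℝ) ≤ k := by exact_mod_cast hk
  have hlog : 1 / 2 ≤ Real.log k := by
    have := Real.log_le_log two_pos hk2
    linarith [Real.log_two_gt_d9]
  have hW : 0 ≤ (k : ℝ) * Real.log k * K ^ (2 * a) * n := by positivity
  have h1 : (((k : ℝ) * Real.log k * K ^ (2 * a) * n) ^ (1 / (2 * (k : ℝ)))) ^ k =
      √((k : ℝ) * Real.log k * K ^ (2 * a) * n) := by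
    rw [← Real.rpow_natCast, ← Real.rpow_mul hW, Real.sqrt_eq_rpow]
    congr 1
    field_simp
  have h2 : √((n : ℝ) * k) * K ^ a ≤ 2 * √((k : ℝ) * Real.log k * K ^ (2 * a) * n) := by
    refine (Real.le_sqrt (by positivity) (by positivity)).2 ?_ |>.trans (le_of_eq (?_ :
      √(4 * ((k : ℝ) * Real.log k * K ^ (2 * a) * n)) = _))
    · rw [mul_pow, Real.sq_sqrt (by positivity), ← Real.rpow_natCast (K ^ a),
        ← Real.rpow_mul hK.le]
      have e : K ^ (a * ((2 : ℕ) : ℝ)) = K ^ (2 * a) := by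
        congr 1
        push_cast
        ring
      rw [e]
      calc (n : ℝ) * k * K ^ (2 * a) = 2 * (n * k * K ^ (2 * a)) * (1 / 2) := by ring
        _ ≤ 2 * (n * k * K ^ (2 * a)) * (2 * Real.log k) := by
            gcongr
            linarith
        _ = _ := by ring
    · rw [Real.sqrt_mul (by norm_num), show (4 : ℝ) = 2 ^ 2 by norm_num,
        Real.sqrt_sq (by norm_num)]
  rw [mul_pow, mul_pow, h1]
  have h3 : (32 : ℝ) ≤ 32 ^ k := le_self_pow₀ (by norm_num) (by omega)
  calc 16 * √(n * k) * K ^ a * ((n : ℝ) ^ b) ^ k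
      = 16 * (√(n * k) * K ^ a) * ((n : ℝ) ^ b) ^ k := by ring
    _ ≤ 16 * (2 * √((k : ℝ) * Real.log k * K ^ (2 * a) * n)) * ((n : ℝ) ^ b) ^ k := by gcongr
    _ = 32 * √((k : ℝ) * Real.log k * K ^ (2 * a) * n) * ((n : ℝ) ^ b) ^ k := by ring
    _ ≤ _ := by gcongr

end Bohr

theorem proposition2p4 :
    ∃ d : ℝ, 0 < d ∧
      ∀ (X : Type*) [NormedAddCommGroup X] [NormedSpace ℂ X] [CompleteSpace X] [Nontrivial X]
        (p lam : ℝ) (_ : 1 ≤ p) (_ : 1 ≤ lam) (q : ℝ≥0∞) (_ : 1 ≤ q)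
        (k n : ℕ) (_ : 2 ≤ k) (_ : 2 ≤ n),
        Bohr.arithmeticBohrRadius (Bohr.homogeneousPolynomials k n X) (Bohr.lqBall q n) p lam ≤
          ENNReal.ofReal
            (d * lam ^ (1 / (p * (k : ℝ))) *
              ((k : ℝ) * Real.log (k : ℝ) *
                ((k ! : ℕ) : ℝ) ^ (2 * (1 - ((min 2 q)⁻¹).toReal)) * (n : ℝ)) ^
                (1 / (2 * (k : ℝ))) *
              (1 / (n : ℝ)) ^ (1 / p + ((max 2 q)⁻¹).toReal - 1 / 2)) := by
  refine ⟨32, by norm_num, ?_⟩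
  intro X _ _ _ _ p lam hp hlam q hq k n hk hn
  refine iSup₂_le fun r hr => ?_
  obtain ⟨ε, hε, hb⟩ := Bohr.exists_signs_polynomial hk hn
    (le_min one_le_two hq : 1 ≤ min 2 q) (min_le_left _ _)
  have hK : (0 : ℝ) < k ! := by exact_mod_cast k.factorial_pos
  have hn0 : (0 : ℝ) < n := by positivity
  have hlogk : 0 ≤ Real.log k := Real.log_natCast_nonneg k
  have h1 := hr.sum_rpow_pow_le hp (by linarith) (M := 16 * √(n * k) *
    (k ! : ℝ) ^ (1 - ((min 2 q)⁻¹).toReal) *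
      ((n : ℝ) ^ (1 / 2 - ((max 2 q)⁻¹).toReal)) ^ k) (by positivity) hε (by
    intro z hz
    refine (hb z).trans ?_
    have h2 : ‖(WithLp.toLp (min 2 q) z : PiLp (min 2 q) (fun _ : Fin n => ℂ))‖ ≤
        (n : ℝ) ^ (1 / 2 - ((max 2 q)⁻¹).toReal) :=
      (Bohr.norm_toLp_min_two_le hq z).trans
        (mul_le_of_le_one_right (by positivity) (le_of_lt hz))
    have : Fact (1 ≤ min 2 q) := ⟨le_min one_le_two hq⟩
    gcongr)
  have h3 := Bohr.arith_mean_le_of_sum_rpow_pow_le (by omega) r hp (by linarith)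
    (D := 32 * ((k : ℝ) * Real.log (k : ℝ) *
      ((k ! : ℕ) : ℝ) ^ (2 * (1 - ((min 2 q)⁻¹).toReal)) * (n : ℝ)) ^ (1 / (2 * (k : ℝ))) *
        (n : ℝ) ^ (1 / 2 - ((max 2 q)⁻¹).toReal)) (by positivity) (by omega)
    (h1.trans (mul_le_mul_of_nonneg_left (Real.rpow_le_rpow (by positivity)
      (Bohr.supNorm_bound_le_pow hk hK hn) (by linarith)) (by linarith)))
  rw [← ENNReal.ofReal_coe_nnreal]
  refine ENNReal.ofReal_le_ofReal ?_
  push_cast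
  refine h3.trans (le_of_eq ?_)
  have e : (1 / (n : ℝ)) ^ (1 / p + ((max 2 q)⁻¹).toReal - 1 / 2) =
      (1 / (n : ℝ)) ^ (1 / p) * (n : ℝ) ^ (1 / 2 - ((max 2 q)⁻¹).toReal) := by
    rw [show 1 / p + ((max 2 q)⁻¹).toReal - 1 / 2 =
        1 / p + -(1 / 2 - ((max 2 q)⁻¹).toReal) by ring,
      Real.rpow_add (by positivity), one_div (n : ℝ), Real.inv_rpow hn0.le (-_),
      Real.rpow_neg hn0.le, inv_inv]
  rw [e]
  ring
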